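/- Let $n,d\ge 0$ be integers and let $\mathcal F$ be a quantum channel on $n\times n$ complex matrices, given by any Kraus representation $\mathcal F(\rho)=\sum_{j=1}^d F_j\rho F_j^\dagger$ with $F_j\in\mathbb C^{n\times n}$ and $\sum_{j=1}^d F_j^\dagger F_j=I$. For a unitary matrix $U$ with eigenvalues $e^{-i\theta_k}$ (counted with multiplicity), where $\theta_k\in(-\pi,\pi]$, put $\|U\|_{\rm sum}=\sum_k|\theta_k|$. Let $\|\mathcal F\|_{\rm sum}$ be the infimum of $\|U\|_{\rm sum}$ over all unitaries $U$ on $B\otimes A$, where $A=\mathbb C^n$ and $B$ is an ancilla of arbitrary finite positive dimension with a fixed basis vector $|0\rangle$, such that $$\mathcal F(\rho)=\operatorname{Tr}_B\big[U(|0\rangle\langle 0|\otimes\rho)U^\dagger\big]\quad\text{for all }\rho.$$ Then $$\|\mathcal F\|_{\rm sum}\;\le\;\min_{v\in\mathbb C^d,\ \|v\|\le 1}\ \sum_{i=1}^n 2\arccos\Big[\operatorname{Re}\,\lambda_i\Big(\sum_{j=1}^d v_jF_j\Big)\Big],$$ where $\|v\|=\big(\sum_j|v_j|^2\big)^{1/2}$,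 $\lambda_1(M),\dots,\lambda_n(M)$ are the eigenvalues of $M$ counted with algebraic multiplicity, and $\arccos$ takes values in $[0,\pi]$; in particular the minimum on the right is attained. -/

import Mathlib

open scoped Kronecker Matrix

noncomputable section

/-- The eigenangles of a unitary matrix `U`, with multiplicity: writing the eigenvalues of `U` as
`exp (-i θ)` with `θ ∈ (-π, π]`, this is the multiset of the angles `θ`. -/
def eigenangles {ι : Type*} [Fintype ι] [DecidableEq ι] (U : Matrix ι ι ℂ) : Multiset ℝ :=
  U.charpoly.roots.map fun z => Complex.arg (starRingEnd ℂ z)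

/-- The sum time-energy `∑ |θ|` of a unitary matrix, over all its eigenangles. -/
def unitarySumEnergy {ι : Type*} [Fintype ι] [DecidableEq ι] (U : Matrix ι ι ℂ) : ℝ :=
  ((eigenangles U).map fun θ => |θ|).sum

/-- The partial trace over the first tensor factor `B` of a matrix on `B ⊗ A`. -/
def partialTraceLeft {B A : Type*} [Fintype B] (M : Matrix (B × A) (B × A) ℂ) : Matrix A A ℂ :=
  Matrix.of fun x y => ∑ b, M (b, x) (b, y)

/-- `U`, acting on `B ⊗ A` with an ancilla `B` of dimension `k + 1` prepared in the state `|0⟩`,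
implements `Φ`: `Φ ρ = Tr_B [U (|0⟩⟨0| ⊗ ρ) U†]` for all `ρ`. -/
def Implements {n k : ℕ}
    (U : Matrix (Fin (k + 1) × Fin n) (Fin (k + 1) × Fin n) ℂ)
    (Φ : Matrix (Fin n) (Fin n) ℂ →ₗ[ℂ] Matrix (Fin n) (Fin n) ℂ) : Prop :=
  ∀ ρ : Matrix (Fin n) (Fin n) ℂ,
    Φ ρ = partialTraceLeft (U * (Matrix.single (0 : Fin (k + 1)) 0 (1 : ℂ) ⊗ₖ ρ) * Uᴴ)

/-- The sum time-energies of all unitaries, with an ancilla of any finite positive dimension,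
that implement `Φ`. -/
def implementationEnergies {n : ℕ}
    (Φ : Matrix (Fin n) (Fin n) ℂ →ₗ[ℂ] Matrix (Fin n) (Fin n) ℂ) : Set ℝ :=
  {e | ∃ (k : ℕ) (U : Matrix (Fin (k + 1) × Fin n) (Fin (k + 1) × Fin n) ℂ),
    U ∈ Matrix.unitaryGroup (Fin (k + 1) × Fin n) ℂ ∧ Implements U Φ ∧ e = unitarySumEnergy U}

/-- The sum time-energy of a channel: the least sum time-energy of a unitary implementing it. -/
def channelSumEnergy {n : ℕ}
    (Φ : Matrix (Fin n) (Fin n) ℂ →ₗ[ℂ] Matrix (Fin n) (Fin n) ℂ) : ℝ :=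
  sInf (implementationEnergies Φ)

/-- `∑ i, 2 arccos (Re (λ_i A))` over the eigenvalues of `A`, counted with algebraic
multiplicity. -/
def eigenvalueBound {n : ℕ} (A : Matrix (Fin n) (Fin n) ℂ) : ℝ :=
  (A.charpoly.roots.map fun z => 2 * Real.arccos z.re).sum

/-- `F` is a Kraus representation of the channel `Φ`. -/
def IsKrausRepresentation {n d : ℕ} (F : Fin d → Matrix (Fin n) (Fin n) ℂ)
    (Φ : Matrix (Fin n) (Fin n) ℂ →ₗ[ℂ] Matrix (Fin n) (Fin n) ℂ) : Prop :=
  ∑ j, (F j)ᴴ * F j = 1 ∧ ∀ ρ : Matrix (Fin n) (Fin n) ℂ, Φ ρ = ∑ j, F j * ρ * (F j)ᴴ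

/-- The infimum defining `channelSumEnergy` is over a set bounded below by `0`. -/
theorem zero_mem_lowerBounds_implementationEnergies {n : ℕ}
    (Φ : Matrix (Fin n) (Fin n) ℂ →ₗ[ℂ] Matrix (Fin n) (Fin n) ℂ) :
    0 ∈ lowerBounds (implementationEnergies Φ) := by
  rintro e ⟨k, U, -, -, rfl⟩
  refine Multiset.sum_nonneg ?_
  intro x hx
  obtain ⟨θ, -, rfl⟩ := Multiset.mem_map.1 hx
  exact abs_nonneg θ

/-- The infimum defining `channelSumEnergy` is over a nonempty set. -/
theorem implementationEnergies_nonempty {n d : ℕ} {F : Fin d → Matrix (Fin n) (Fin n) ℂ}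
    {Φ : Matrix (Fin n) (Fin n) ℂ →ₗ[ℂ] Matrix (Fin n) (Fin n) ℂ}
    (hF : IsKrausRepresentation F Φ) : (implementationEnergies Φ).Nonempty := by
  classical
  obtain ⟨h1, hΦ⟩ := hF
  let G : Fin (d + 1) → Matrix (Fin n) (Fin n) ℂ := Fin.snoc F 0
  have hG1 : ∑ j, (G j)ᴴ * G j = 1 := by
    rw [Fin.sum_univ_castSucc]; simpa [G] using h1
  have hGΦ : ∀ ρ, Φ ρ = ∑ j, G j * ρ * (G j)ᴴ := by
    intro ρ
    rw [Fin.sum_univ_castSucc]; simpa [G] using hΦ ρ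
  let w : Fin (d + 1) × Fin n → EuclideanSpace ℂ (Fin (d + 1) × Fin n) := fun q =>
    WithLp.toLp 2 fun p => G p.1 p.2 q.2
  let s : Set (Fin (d + 1) × Fin n) := {q | q.1 = 0}
  have hw : ∀ q r : Fin (d + 1) × Fin n,
      inner ℂ (w q) (w r) = if q.2 = r.2 then (1 : ℂ) else 0 := by
    intro q r
    have h := congrFun (congrFun hG1 q.2) r.2
    rw [Matrix.one_apply] at h
    rw [← h, PiLp.inner_apply, Fintype.sum_prod_type, Matrix.sum_apply]
    simp [w, Matrix.mul_apply, mul_comm]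
  have hon : Orthonormal ℂ (s.domRestrict w) := by
    rw [orthonormal_iff_ite]
    rintro ⟨q, hq⟩ ⟨r, hr⟩
    simp only [Set.domRestrict_apply, hw]
    have hq' : q.1 = 0 := hq
    have hr' : r.1 = 0 := hr
    simp [Prod.ext_iff, hq', hr']
  obtain ⟨b, hb⟩ := hon.exists_orthonormalBasis_extension_of_card_eq (by simp)
  let U : Matrix (Fin (d + 1) × Fin n) (Fin (d + 1) × Fin n) ℂ := Matrix.of fun p q => b q p
  have hU : U ∈ Matrix.unitaryGroup (Fin (d + 1) × Fin n) ℂ := by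
    rw [Matrix.mem_unitaryGroup_iff']
    ext q r
    have h := orthonormal_iff_ite.1 b.orthonormal q r
    rw [PiLp.inner_apply] at h
    rw [Matrix.one_apply, ← h, Matrix.star_eq_conjTranspose, Matrix.mul_apply]
    simp [U, mul_comm]
  refine ⟨_, d, U, hU, ?_, rfl⟩
  intro ρ
  have hcol : ∀ p a, U p (0, a) = G p.1 p.2 a := by
    intro p a
    have h : b (0, a) = w (0, a) := hb (0, a) rfl
    simp [U, w, h]
  rw [hGΦ]
  ext x y
  simp only [partialTraceLeft, Matrix.of_apply, Matrix.sum_apply]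
  refine Finset.sum_congr rfl fun j _ => ?_
  simp [Matrix.mul_apply, Fintype.sum_prod_type, Matrix.kroneckerMap_apply, Matrix.single_apply,
    hcol, ite_and, Finset.sum_ite_eq, Finset.sum_mul]

end

/-! Fix `v` with norm at most `1`. Adding a zero Kraus operator leaves room to complete `v` to a
unit vector, and that vector to a unitary; mixing the Kraus operators by it gives a representation
`G` of the same channel with `G 0 = ∑ j, v j • F j`. Let `Q` triangularise `G 0`, with columns
`q_i`. A unitary implements the channel once it sends each `e_i = |0⟩ ⊗ q_i` to `f_i = ∑ k, |k⟩ ⊗ G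
k q_i`. Both families are orthonormal, and their overlaps `⟨e_i, f_j⟩` form the triangular matrix
`Qᴴ * G 0 * Q`, whose diagonal lists the eigenvalues.

Triangularity lets the vectors be moved one at a time: the rotation taking `e_i` to `f_i` inside
their span disturbs neither the `f_j` already placed nor, when it comes earlier, a later `e_j`
(`exists_unitary_mulVec_eq_of_triangular`). Each rotation is a product of at most two rank-one phase
rotations, of total angle at most `2 arccos (Re ⟨e_i, f_i⟩)` (`exists_unitary_mulVec_eq`).

The costs add because a rank-one phase rotation of angle `t` raises the sum energy by at most `|t|`
(`unitarySumEnergy_phaseRotation_mul_le`). Eigenvalue branches are never followed. Instead `|arg z|`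
is replaced by `Re p(z)` for a polynomial `p`, and `Re tr p(R_t U)` is differentiated in `t`: with
`V = R_t U` and axis `u`, the derivative is `-Im ⟨u, V p'(V) u⟩`, at most `sup |Im (z p'(z))|` over
the circle. `exists_polynomial_near_abs_arg` makes this supremum nearly `1`.

The minimum exists by compactness of the set of pairs `(v, Q)` with `Q` triangularising, which
avoids continuity of eigenvalues. -/

/-! ### Unitary triangularisation and diagonalisation. -/

/-- Schur triangularization by an orthonormal family; for an isometry the result is diagonal. -/
theorem exists_orthonormal_inner_apply_eq_zero (n : ℕ) :
    ∀ (E : Type*) [NormedAddCommGroup E] [InnerProductSpace ℂ E] [FiniteDimensional ℂ E],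
      Module.finrank ℂ E = n → ∀ T : E →ₗ[ℂ] E, ∃ x : Fin n → E, Orthonormal ℂ x ∧
        (∀ i j, j < i → inner ℂ (x i) (T (x j)) = 0) ∧
        ((∀ y z, inner ℂ (T y) (T z) = inner ℂ y z) →
          ∀ i j, i ≠ j → inner ℂ (x i) (T (x j)) = 0) := by
  induction n with
  | zero =>
    intro E _ _ _ _ T
    exact ⟨Fin.elim0, ⟨fun i => i.elim0, fun i => i.elim0⟩, fun i => i.elim0,
      fun _ i => i.elim0⟩
  | succ n ih =>
    intro E _ _ _ hE T
    have : Nontrivial E := Module.nontrivial_of_finrank_pos (R := ℂ) (by omega)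
    -- An eigenvector of the adjoint is placed last: its orthogonal complement is `T`-invariant, and
    -- the induction runs there.
    obtain ⟨μ, hμ⟩ := Module.End.exists_eigenvalue (LinearMap.adjoint T)
    obtain ⟨w, hw⟩ := hμ.exists_hasEigenvector
    obtain ⟨u, hu, hTu⟩ : ∃ u : E, ‖u‖ = 1 ∧ LinearMap.adjoint T u = μ • u := by
      have hw0 : (‖w‖ : ℂ) ≠ 0 := by simpa using hw.2
      refine ⟨((‖w‖ : ℂ)⁻¹) • w, by simp [norm_smul, hw.2], ?_⟩
      rw [map_smul, hw.apply_eq_smul, smul_comm]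
    let K : Submodule ℂ E := (ℂ ∙ u)ᗮ
    have hK : ∀ y, y ∈ K ↔ inner ℂ u y = 0 := fun y => Submodule.mem_orthogonal_singleton_iff_inner_right
    have hTK : ∀ y ∈ K, T y ∈ K := by
      intro y hy
      rw [hK] at hy ⊢
      rw [← LinearMap.adjoint_inner_left, hTu, inner_smul_left, hy, mul_zero]
    have hu0 : u ≠ 0 := by rintro rfl; simp at hu
    have hfin : Module.finrank ℂ K = n := by
      have : Fact (Module.finrank ℂ E = n + 1) := ⟨hE⟩
      exact Submodule.finrank_orthogonal_span_singleton hu0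
    obtain ⟨x, hx, hx1, hx2⟩ := ih K hfin (T.restrict hTK)
    have hux : ∀ i, inner ℂ u (x i : E) = 0 := fun i => (hK _).1 (x i).2
    have hxu : ∀ i, inner ℂ (x i : E) u = 0 := fun i => inner_eq_zero_symm.1 (hux i)
    have huT : ∀ i, inner ℂ u (T (x i)) = 0 := fun i => (hK _).1 (hTK _ (x i).2)
    refine ⟨Fin.snoc (fun i => (x i : E)) u, ?_, ?_, ?_⟩
    · rw [orthonormal_iff_ite] at hx ⊢
      intro i j
      induction i using Fin.lastCases with
      | last =>
        induction j using Fin.lastCases with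
        | last => simp [hu]
        | cast j => simp [hux, (Fin.castSucc_lt_last j).ne']
      | cast i =>
        induction j using Fin.lastCases with
        | last => simp [hxu, (Fin.castSucc_lt_last i).ne]
        | cast j => simpa using hx i j
    · intro i j hij
      induction i using Fin.lastCases with
      | last =>
        induction j using Fin.lastCases with
        | last => exact absurd hij (lt_irrefl _)
        | cast j => simpa using huT j
      | cast i =>
        induction j using Fin.lastCases with
        | last => exact absurd (hij.trans (Fin.castSucc_lt_last i)) (lt_irrefl _)
        | cast j => simpa using hx1 i j (by simpa using hij)
    · intro hT i j hij
      induction i using Fin.lastCases with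
      | last =>
        induction j using Fin.lastCases with
        | last => exact absurd rfl hij
        | cast j => simpa using huT j
      | cast i =>
        induction j using Fin.lastCases with
        | last =>
          -- In finite dimension an isometry also satisfies `T T* = 1`, so `u` is an eigenvector of
          -- `T` itself and the last column is diagonal.
          have h1 : LinearMap.adjoint T ∘ₗ T = LinearMap.id := by
            ext y
            refine ext_inner_left ℂ fun z => ?_
            simp [LinearMap.adjoint_inner_right, hT]
          have h2 : T ∘ₗ LinearMap.adjoint T = LinearMap.id := mul_eq_one_comm.1 h1
          have h3 : μ • T u = u := by
            have := LinearMap.congr_fun h2 u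
            simpa [hTu] using this
          have h4 : μ * inner ℂ (x i : E) (T u) = 0 := by
            rw [← inner_smul_right, h3, hxu]
          have hμ0 : μ ≠ 0 := by
            rintro rfl
            exact hu0 (by simpa using h3.symm)
          simpa using (mul_eq_zero.1 h4).resolve_left hμ0
        | cast j =>
          simpa using hx2 (fun y z => by simpa using hT y z) i j (by rintro rfl; exact hij rfl)

theorem exists_unitary_conj {ι : Type*} [Fintype ι] [DecidableEq ι] {n : ℕ} (e : Fin n ≃ ι)
    (A : Matrix ι ι ℂ) : ∃ Q ∈ Matrix.unitaryGroup ι ℂ,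
      (∀ i j, e.symm j < e.symm i → (Qᴴ * A * Q) i j = 0) ∧
      (A ∈ Matrix.unitaryGroup ι ℂ → ∀ i j, i ≠ j → (Qᴴ * A * Q) i j = 0) := by
  have hcard : Module.finrank ℂ (EuclideanSpace ℂ ι) = n := by
    simpa using (Fintype.card_congr e).symm
  obtain ⟨x, hx, h1, h2⟩ := exists_orthonormal_inner_apply_eq_zero n (EuclideanSpace ℂ ι) hcard
    (Matrix.toEuclideanLin A)
  let Q : Matrix ι ι ℂ := Matrix.of fun a i => x (e.symm i) a
  have hent : ∀ i j, (Qᴴ * A * Q) i j =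
      inner ℂ (x (e.symm i)) (Matrix.toEuclideanLin A (x (e.symm j))) := by
    intro i j
    rw [PiLp.inner_apply, Matrix.mul_assoc, Matrix.mul_apply]
    refine Finset.sum_congr rfl fun a _ => ?_
    simp [Q, Matrix.mul_apply, Matrix.mulVec, dotProduct, mul_comm, Matrix.toLpLin_apply]
  refine ⟨Q, ?_, fun i j hij => ?_, fun hA i j hij => ?_⟩
  · rw [Matrix.mem_unitaryGroup_iff']
    ext i j
    have h := orthonormal_iff_ite.1 hx (e.symm i) (e.symm j)
    rw [PiLp.inner_apply] at h
    simp only [EmbeddingLike.apply_eq_iff_eq] at h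
    rw [Matrix.one_apply, ← h, Matrix.star_eq_conjTranspose, Matrix.mul_apply]
    simp [Q, mul_comm]
  · rw [hent, h1 _ _ hij]
  · rw [hent]
    refine h2 (fun y z => ?_) _ _ (by simpa using hij)
    rw [← LinearMap.adjoint_inner_right, ← Matrix.toEuclideanLin_conjTranspose_eq_adjoint]
    have h3 : Aᴴ * A = 1 := Matrix.mem_unitaryGroup_iff'.1 hA
    congr 1
    simp [Matrix.toLpLin_apply, h3]

theorem exists_unitary_isUpperTriangular {n : ℕ} (A : Matrix (Fin n) (Fin n) ℂ) :
    ∃ Q ∈ Matrix.unitaryGroup (Fin n) ℂ, (Qᴴ * A * Q).IsUpperTriangular := by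
  obtain ⟨Q, hQ, h, -⟩ := exists_unitary_conj (Equiv.refl (Fin n)) A
  exact ⟨Q, hQ, fun i j hij => h i j hij⟩

/-! ### Polynomial approximation of `|arg z|` on the unit circle. -/

section

open scoped Real

/-- The Fourier series of the triangle wave. -/
theorem hasSum_cos_odd {θ : ℝ} (h0 : 0 ≤ θ) (h1 : θ ≤ π) :
    HasSum (fun n : ℕ => Real.cos ((2 * n + 1) * θ) / (2 * n + 1) ^ 2) (π ^ 2 / 8 - π * θ / 4) := by
  have hb : ∀ x : ℝ, (Polynomial.map (algebraMap ℚ ℝ) (Polynomial.bernoulli 2)).eval x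
      = x ^ 2 - x + 1 / 6 := by
    intro x
    have hB : bernoulli 2 = 1 / 6 := by
      rw [bernoulli_eq_bernoulli'_of_ne_one (by norm_num), bernoulli'_two]
    simp [Polynomial.bernoulli_def, Finset.sum_range_succ, hB, bernoulli_one]
    ring
  have hx : θ / (2 * π) ∈ Set.Icc (0 : ℝ) 1 :=
    ⟨by positivity, by rw [div_le_one (by positivity)]; linarith⟩
  have hx2 : θ / π ∈ Set.Icc (0 : ℝ) 1 :=
    ⟨by positivity, by rw [div_le_one (by positivity)]; linarith⟩
  have A := hasSum_one_div_nat_pow_mul_cos one_ne_zero hx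
  have B := (hasSum_one_div_nat_pow_mul_cos one_ne_zero hx2).mul_left (1 / 4)
  rw [mul_one, hb] at A B
  -- The Bernoulli series at `θ / (2π)` minus its even terms, which are a quarter of the series at
  -- `θ / π`. The term at index `0` is harmless, being `1 / 0 = 0`.
  let f : ℕ → ℝ := fun n => 1 / (n : ℝ) ^ 2 * Real.cos (2 * π * n * (θ / (2 * π)))
  have hfB : ∀ k : ℕ, f (2 * k) = 1 / 4 * (1 / (k : ℝ) ^ 2 * Real.cos (2 * π * k * (θ / π))) := by
    intro k
    have e : 2 * π * ((2 * k : ℕ) : ℝ) * (θ / (2 * π)) = 2 * π * k * (θ / π) := by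
      push_cast; field_simp
    simp only [f]
    rw [e]
    push_cast
    ring
  have he := B
  simp_rw [← hfB] at he
  have ho : Summable fun k => f (2 * k + 1) :=
    A.summable.comp_injective (i := fun k : ℕ => 2 * k + 1) (fun a b h => by simpa using h)
  have hu := (he.even_add_odd ho.hasSum).unique A
  have hs : HasSum (fun k => f (2 * k + 1)) (π ^ 2 / 8 - π * θ / 4) := by
    convert ho.hasSum using 1
    rw [← sub_eq_iff_eq_add'.2 hu.symm]
    simp only [Nat.factorial]
    push_cast
    field_simp
    ring
  convert hs using 2 with n
  have e : 2 * π * ((2 * n + 1 : ℕ) : ℝ) * (θ / (2 * π)) = (2 * n + 1) * θ := by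
    push_cast; field_simp
  simp only [f]
  rw [e]
  push_cast
  ring

theorem re_pow_of_norm_eq_one {z : ℂ} (hz : ‖z‖ = 1) (k : ℕ) :
    (z ^ k).re = Real.cos (k * |z.arg|) := by
  have h : z = Complex.exp (z.arg * Complex.I) := by
    simpa [hz] using (Complex.norm_mul_exp_arg_mul_I z).symm
  conv_lhs => rw [h, ← Complex.exp_nat_mul]
  rw [show (k : ℂ) * (z.arg * Complex.I) = ((k * z.arg : ℝ) : ℂ) * Complex.I by push_cast; ring,
    Complex.exp_ofReal_mul_I_re]
  rcases abs_cases z.arg with ⟨h, -⟩ | ⟨h, -⟩ <;> rw [h]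
  rw [mul_neg, Real.cos_neg]

theorem hasSum_re_pow_odd {z : ℂ} (hz : ‖z‖ = 1) :
    HasSum (fun n : ℕ => (z ^ (2 * n + 1)).re / (2 * n + 1) ^ 2)
      (π ^ 2 / 8 - π * |z.arg| / 4) := by
  convert hasSum_cos_odd (abs_nonneg z.arg) (Complex.abs_arg_le_pi z) using 3 with n
  rw [re_pow_of_norm_eq_one hz]
  push_cast
  rfl

/-- The sum is `artanh w`, that is, half of `log ((1 + w) / (1 - w))`. The Möbius map sends the disc
into the right half-plane, where `|arg| ≤ π / 2`. -/
theorem hasSum_pow_odd_div {w : ℂ} (hw : ‖w‖ < 1) :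
    ∃ s : ℂ, HasSum (fun n : ℕ => w ^ (2 * n + 1) / ((2 * n + 1 : ℕ) : ℂ)) s ∧ |s.im| ≤ π / 4 := by
  have h := (Complex.hasSum_arctan (z := -Complex.I * w) (by simpa using hw)).mul_left Complex.I
  have e1 : 1 + -Complex.I * w * Complex.I = 1 + w := by
    linear_combination -w * Complex.I_mul_I
  have e2 : 1 - -Complex.I * w * Complex.I = 1 - w := by
    linear_combination w * Complex.I_mul_I
  have e3 : Complex.I * Complex.arctan (-Complex.I * w) =
      ((1 / 2 : ℝ) : ℂ) * Complex.log ((1 + w) / (1 - w)) := by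
    rw [Complex.arctan, e1, e2]
    push_cast
    linear_combination (-1 / 2 * Complex.log ((1 + w) / (1 - w))) * Complex.I_mul_I
  refine ⟨Complex.I * Complex.arctan (-Complex.I * w), ?_, ?_⟩
  · convert! h using 2 with n
    rw [mul_pow, pow_succ (-Complex.I), pow_mul (-Complex.I), neg_sq, Complex.I_sq]
    have h4 : ((-1 : ℂ) ^ n) * (-1) ^ n = 1 := by rw [← mul_pow]; simp
    have h5 : Complex.I * ((-1) ^ n * ((-1) ^ n * -Complex.I * w ^ (2 * n + 1))) =
        w ^ (2 * n + 1) := by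
      linear_combination w ^ (2 * n + 1) * h4 -
        (w ^ (2 * n + 1) * ((-1 : ℂ) ^ n) * (-1) ^ n) * Complex.I_mul_I
    rw [mul_div_assoc', h5]
  · rw [e3, Complex.im_ofReal_mul, Complex.log_im, abs_mul, abs_of_pos (by norm_num : (0 : ℝ) < 1 / 2)]
    have hre : 0 ≤ ((1 + w) / (1 - w)).re := by
      rw [Complex.div_re, ← add_div]
      refine div_nonneg ?_ (Complex.normSq_nonneg _)
      have h5 : w.re * w.re + w.im * w.im < 1 := by
        rw [← Complex.normSq_apply, Complex.normSq_eq_norm_sq]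
        exact pow_lt_one₀ (norm_nonneg _) hw two_ne_zero
      simp
      nlinarith
    have := Complex.abs_arg_le_pi_div_two_iff.2 hre
    linarith

/-- Polynomials whose real part approximates `|arg z|` on the unit circle, with an angular
derivative there that is bounded by almost `1`. -/
theorem exists_polynomial_near_abs_arg {ε : ℝ} (hε : 0 < ε) :
    ∃ p : Polynomial ℂ, ∀ z : ℂ, ‖z‖ = 1 →
      |(p.eval z).re - (|z.arg|)| ≤ ε ∧ |(z * p.derivative.eval z).im| ≤ 1 + ε := by
  let a : ℕ → ℝ := fun n => 1 / (2 * n + 1) ^ 2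
  have ha0 : ∀ n, 0 ≤ a n := fun n => by positivity
  have ha : Summable a := by
    have := (hasSum_cos_odd le_rfl Real.pi_pos.le).summable
    simpa [a] using this
  -- Abel damping by `r ^ (2 * n + 1)` changes the values by an amount vanishing as `r → 1`. It
  -- turns the angular derivative into `artanh (r z)`, which has bounded imaginary part.
  have hT : Filter.Tendsto (fun r : ℝ => ∑' n, a n * (1 - r ^ (2 * n + 1))) (nhdsWithin 1 (Set.Iio 1))
      (nhds (∑' n, a n * (1 - 1 ^ (2 * n + 1)))) := by
    refine tendsto_tsum_of_dominated_convergence ha (fun k => ?_) ?_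
    · refine Filter.Tendsto.mono_left ?_ nhdsWithin_le_nhds
      exact Continuous.tendsto (f := fun r : ℝ => a k * (1 - r ^ (2 * k + 1))) (by fun_prop) 1
    · filter_upwards [Ioo_mem_nhdsLT (zero_lt_one' ℝ)] with r hr k
      have h1 : r ^ (2 * k + 1) ≤ 1 := pow_le_one₀ hr.1.le hr.2.le
      have h2 : 0 ≤ r ^ (2 * k + 1) := pow_nonneg hr.1.le _
      rw [norm_mul, Real.norm_of_nonneg (ha0 k), Real.norm_of_nonneg (by linarith)]
      exact mul_le_of_le_one_right (ha0 k) (by linarith)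
  simp only [one_pow, sub_self, mul_zero, tsum_zero] at hT
  have hδ : 0 < ε / 3 := by positivity
  obtain ⟨r, hr1, hr⟩ := ((hT.eventually_lt_const hδ).and (Ioo_mem_nhdsLT (zero_lt_one' ℝ))).exists
  have hk0 : ∀ n : ℕ, 0 ≤ r ^ (2 * n + 1) := fun n => pow_nonneg hr.1.le _
  have hk1 : ∀ n : ℕ, r ^ (2 * n + 1) ≤ 1 := fun n => pow_le_one₀ hr.1.le hr.2.le
  have hrs : Summable fun n : ℕ => r ^ (2 * n + 1) :=
    (summable_geometric_of_lt_one hr.1.le hr.2).comp_injective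
      (i := fun k : ℕ => 2 * k + 1) (fun a b h => by simpa using h)
  -- One truncation index serves both tails: `a` for the values, the geometric series for the
  -- derivative.
  obtain ⟨N, hN1, hN2⟩ := (((tendsto_sum_nat_add a).eventually_lt_const hδ).and
    ((tendsto_sum_nat_add fun n : ℕ => r ^ (2 * n + 1)).eventually_lt_const hδ)).exists
  have hpi : 4 / π ≤ 4 / 3 := div_le_div_of_nonneg_left (by norm_num) (by norm_num) Real.pi_gt_three.le
  have hpi0 : 0 < 4 / π := by positivity
  refine ⟨Polynomial.C ((π / 2 : ℝ) : ℂ) - Polynomial.C ((4 / π : ℝ) : ℂ) *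
    ∑ n ∈ Finset.range N, Polynomial.C ((a n * r ^ (2 * n + 1) : ℝ) : ℂ) *
      Polynomial.X ^ (2 * n + 1), fun z hz => ⟨?_, ?_⟩⟩
  · have hre : ∀ n : ℕ, |(z ^ (2 * n + 1)).re| ≤ 1 := fun n =>
      (Complex.abs_re_le_norm _).trans (by simp [hz])
    have hs := hasSum_re_pow_odd hz
    have hs1 := hs.summable
    have hsplit := hs1.sum_add_tsum_nat_add N
    rw [hs.tsum_eq] at hsplit
    have hev : (Polynomial.eval z (Polynomial.C ((π / 2 : ℝ) : ℂ) - Polynomial.C ((4 / π : ℝ) : ℂ) *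
        ∑ n ∈ Finset.range N, Polynomial.C ((a n * r ^ (2 * n + 1) : ℝ) : ℂ) *
          Polynomial.X ^ (2 * n + 1))).re =
        π / 2 - 4 / π * ∑ n ∈ Finset.range N, a n * r ^ (2 * n + 1) * (z ^ (2 * n + 1)).re := by
      simp only [Polynomial.eval_sub, Polynomial.eval_mul, Polynomial.eval_C,
        Polynomial.eval_finsetSum, Polynomial.eval_pow, Polynomial.eval_X, Complex.sub_re,
        Complex.re_ofReal_mul, Complex.ofReal_re, Complex.re_sum]
    have h1 : |∑ n ∈ Finset.range N, (z ^ (2 * n + 1)).re / (2 * n + 1) ^ 2 -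
        ∑ n ∈ Finset.range N, a n * r ^ (2 * n + 1) * (z ^ (2 * n + 1)).re| ≤ ε / 3 := by
      rw [← Finset.sum_sub_distrib]
      refine ((Finset.abs_sum_le_sum_abs _ _).trans
        (Finset.sum_le_sum (g := fun n => a n * (1 - r ^ (2 * n + 1))) fun n _ => ?_)).trans
          (le_trans ?_ hr1.le)
      · rw [show (z ^ (2 * n + 1)).re / (2 * n + 1) ^ 2 - a n * r ^ (2 * n + 1) * (z ^ (2 * n + 1)).re
          = a n * (1 - r ^ (2 * n + 1)) * (z ^ (2 * n + 1)).re by simp only [a]; ring, abs_mul,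
          abs_of_nonneg (mul_nonneg (ha0 n) (sub_nonneg.2 (hk1 n)))]
        exact mul_le_of_le_one_right (mul_nonneg (ha0 n) (sub_nonneg.2 (hk1 n))) (hre n)
      · refine Summable.sum_le_tsum _ (fun n _ => mul_nonneg (ha0 n) (sub_nonneg.2 (hk1 n))) ?_
        refine Summable.of_nonneg_of_le (fun n => mul_nonneg (ha0 n) (sub_nonneg.2 (hk1 n)))
          (fun n => ?_) ha
        exact mul_le_of_le_one_right (ha0 n) (by linarith [hk0 n])
    have h2 : |∑' n : ℕ, (z ^ (2 * (n + N) + 1)).re / (2 * ((n + N : ℕ) : ℝ) + 1) ^ 2| ≤ ε / 3 := by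
      refine le_trans ?_ hN1.le
      rw [← Real.norm_eq_abs]
      refine tsum_of_norm_bounded (g := fun k => a (k + N)) ((summable_nat_add_iff N).2 ha).hasSum
        fun n => ?_
      rw [Real.norm_eq_abs, abs_div, abs_of_nonneg (by positivity : (0:ℝ) ≤ (2 * ((n + N : ℕ) : ℝ) + 1) ^ 2)]
      exact div_le_div_of_nonneg_right (hre _) (by positivity)
    rw [hev]
    set S := ∑ n ∈ Finset.range N, (z ^ (2 * n + 1)).re / (2 * n + 1) ^ 2
    set S' := ∑ n ∈ Finset.range N, a n * r ^ (2 * n + 1) * (z ^ (2 * n + 1)).re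
    set R := ∑' n : ℕ, (z ^ (2 * (n + N) + 1)).re / (2 * ((n + N : ℕ) : ℝ) + 1) ^ 2
    have h3 : |z.arg| = π / 2 - 4 / π * (S + R) := by
      rw [hsplit]; field_simp; ring
    rw [h3, show π / 2 - 4 / π * S' - (π / 2 - 4 / π * (S + R)) = 4 / π * ((S - S') + R) by ring,
      abs_mul, abs_of_pos hpi0]
    calc 4 / π * |(S - S') + R| ≤ 4 / 3 * (ε / 3 + ε / 3) :=
          mul_le_mul hpi ((abs_add_le _ _).trans (add_le_add h1 h2)) (abs_nonneg _) (by norm_num)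
      _ ≤ ε := by linarith
  · obtain ⟨s, hs, hs'⟩ := hasSum_pow_odd_div (w := r * z) (by
      rw [norm_mul, hz, mul_one, Complex.norm_real, Real.norm_of_nonneg hr.1.le]; exact hr.2)
    have hsplit := hs.summable.sum_add_tsum_nat_add N
    rw [hs.tsum_eq] at hsplit
    have h2 : ‖∑' n : ℕ, (r * z) ^ (2 * (n + N) + 1) / ((2 * (n + N) + 1 : ℕ) : ℂ)‖ ≤ ε / 3 := by
      refine le_trans ?_ hN2.le
      refine tsum_of_norm_bounded (g := fun k => r ^ (2 * (k + N) + 1))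
        ((summable_nat_add_iff N).2 hrs).hasSum fun n => ?_
      rw [norm_div, norm_pow, norm_mul, hz, mul_one, Complex.norm_real,
        Real.norm_of_nonneg hr.1.le, Complex.norm_natCast]
      exact div_le_self (hk0 _) (by exact_mod_cast Nat.succ_le_succ (Nat.zero_le _))
    have hev : z * Polynomial.eval z (Polynomial.derivative (Polynomial.C ((π / 2 : ℝ) : ℂ) -
        Polynomial.C ((4 / π : ℝ) : ℂ) *
        ∑ n ∈ Finset.range N, Polynomial.C ((a n * r ^ (2 * n + 1) : ℝ) : ℂ) *
          Polynomial.X ^ (2 * n + 1))) = ((-(4 / π) : ℝ) : ℂ) *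
          ∑ n ∈ Finset.range N, (r * z) ^ (2 * n + 1) / ((2 * n + 1 : ℕ) : ℂ) := by
      simp only [Polynomial.derivative_sub, Polynomial.derivative_C, Polynomial.derivative_C_mul,
        Polynomial.derivative_sum, Polynomial.derivative_X_pow, zero_sub, Polynomial.eval_neg,
        Polynomial.eval_mul, Polynomial.eval_C, Polynomial.eval_finsetSum, Polynomial.eval_pow,
        Polynomial.eval_X, Nat.add_sub_cancel]
      rw [mul_neg, mul_left_comm, Complex.ofReal_neg, neg_mul, Finset.mul_sum]
      congr 2
      refine Finset.sum_congr rfl fun n _ => ?_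
      have hn : (2 * (n : ℂ) + 1) ≠ 0 := by exact_mod_cast Nat.succ_ne_zero (2 * n)
      simp only [a]
      push_cast
      field_simp
      ring
    rw [hev, Complex.im_ofReal_mul, abs_mul, abs_neg, abs_of_pos hpi0]
    set S := ∑ n ∈ Finset.range N, (r * z) ^ (2 * n + 1) / ((2 * n + 1 : ℕ) : ℂ)
    set R := ∑' n : ℕ, (r * z) ^ (2 * (n + N) + 1) / ((2 * (n + N) + 1 : ℕ) : ℂ)
    have hR : |R.im| ≤ ε / 3 := (Complex.abs_im_le_norm _).trans h2
    have hS : |S.im| ≤ π / 4 + ε / 3 := by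
      rw [show S.im = s.im - R.im by rw [← hsplit, Complex.add_im]; ring]
      exact (abs_sub _ _).trans (add_le_add hs' hR)
    calc 4 / π * |S.im| ≤ 4 / π * (π / 4 + ε / 3) := mul_le_mul_of_nonneg_left hS hpi0.le
      _ = 1 + 4 / π * (ε / 3) := by field_simp
      _ ≤ 1 + ε := by nlinarith

end

/-! ### Spectral calculus for unitaries and derivatives of traces. -/

section

variable {ι : Type*} [Fintype ι] [DecidableEq ι]

theorem exists_unitary_mul_diagonal {U : Matrix ι ι ℂ} (hU : U ∈ Matrix.unitaryGroup ι ℂ) :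
    ∃ Q ∈ Matrix.unitaryGroup ι ℂ, ∃ z : ι → ℂ, (∀ i, ‖z i‖ = 1) ∧
      U = Q * Matrix.diagonal z * Qᴴ := by
  obtain ⟨Q, hQ, -, h⟩ := exists_unitary_conj (Fintype.equivFin ι).symm U
  have hQ1 : Qᴴ * Q = 1 := Matrix.mem_unitaryGroup_iff'.1 hQ
  have hQ2 : Q * Qᴴ = 1 := Matrix.mem_unitaryGroup_iff.1 hQ
  have hU1 : Uᴴ * U = 1 := Matrix.mem_unitaryGroup_iff'.1 hU
  have hD : Qᴴ * U * Q = Matrix.diagonal (Qᴴ * U * Q).diag := by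
    ext i j
    rcases eq_or_ne i j with rfl | hij
    · simp
    · rw [h hU i j hij, Matrix.diagonal_apply_ne _ hij]
  refine ⟨Q, hQ, (Qᴴ * U * Q).diag, fun i => ?_, ?_⟩
  · have h1 : (Qᴴ * U * Q)ᴴ * (Qᴴ * U * Q) = 1 := by
      calc _ = Qᴴ * (Uᴴ * (Q * Qᴴ) * U) * Q := by
              simp only [Matrix.conjTranspose_mul, Matrix.conjTranspose_conjTranspose,
                Matrix.mul_assoc]
        _ = 1 := by rw [hQ2, Matrix.mul_one, hU1, Matrix.mul_one, hQ1]
    have h2 := congrFun (congrFun h1 i) i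
    rw [hD, Matrix.diagonal_conjTranspose, Matrix.diagonal_mul_diagonal] at h2
    simp only [Matrix.diagonal_apply_eq, Matrix.one_apply_eq, Pi.star_apply] at h2
    have h3 : ‖(Qᴴ * U * Q).diag i‖ ^ 2 = 1 := by
      have h4 := Complex.conj_mul' ((Qᴴ * U * Q).diag i)
      have h5 := h4.symm.trans h2
      exact_mod_cast h5
    exact (pow_eq_one_iff_of_nonneg (norm_nonneg _) two_ne_zero).1 h3
  · rw [← hD]
    calc U = (Q * Qᴴ) * U * (Q * Qᴴ) := by rw [hQ2, Matrix.mul_one, Matrix.one_mul]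
      _ = _ := by simp only [Matrix.mul_assoc]

theorem aeval_mul_eq_mul_diagonal {U Q : Matrix ι ι ℂ} {z : ι → ℂ}
    (h : U * Q = Q * Matrix.diagonal z) (p : Polynomial ℂ) :
    Polynomial.aeval U p * Q = Q * Matrix.diagonal fun i => p.eval (z i) := by
  induction p using Polynomial.induction_on' with
  | add p q hp hq =>
    simp only [map_add, add_mul, hp, hq, Polynomial.eval_add, ← Matrix.mul_add,
      Matrix.diagonal_add]
  | monomial k a =>
    have hs : SemiconjBy Q (Matrix.diagonal z) U := h.symm
    have hk : U ^ k * Q = Q * Matrix.diagonal z ^ k := (hs.pow_right k).symm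
    rw [Polynomial.aeval_monomial, Algebra.algebraMap_eq_smul_one, smul_one_mul, Matrix.smul_mul, hk, Matrix.diagonal_pow,
      ← Matrix.mul_smul, ← Matrix.diagonal_smul]
    congr 2
    ext i
    simp

theorem charpoly_unitary_conj {Q : Matrix ι ι ℂ} (hQ : Q ∈ Matrix.unitaryGroup ι ℂ)
    (T : Matrix ι ι ℂ) : (Q * T * Qᴴ).charpoly = T.charpoly := by
  have hQ1 : Qᴴ * Q = 1 := Matrix.mem_unitaryGroup_iff'.1 hQ
  rw [Matrix.mul_assoc, Matrix.charpoly_mul_comm, Matrix.mul_assoc, hQ1, Matrix.mul_one]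

/-- On the negative axis `arg` is `π` and conjugation fixes it; elsewhere the sign flips. Hence the
sign convention for eigenangles does not affect the energy. -/
theorem abs_arg_conj (z : ℂ) : |Complex.arg (starRingEnd ℂ z)| = |Complex.arg z| := by
  rw [Complex.arg_conj]
  split_ifs with h
  · rw [h]
  · rw [abs_neg]

theorem unitarySumEnergy_conj_diagonal {Q : Matrix ι ι ℂ} (hQ : Q ∈ Matrix.unitaryGroup ι ℂ)
    (z : ι → ℂ) : unitarySumEnergy (Q * Matrix.diagonal z * Qᴴ) = ∑ i, |Complex.arg (z i)| := by
  have : (Matrix.diagonal z).charpoly.roots = Finset.univ.val.map z := by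
    rw [Matrix.charpoly_diagonal, ← Polynomial.roots_multiset_prod_X_sub_C
      (Finset.univ.val.map z), Multiset.map_map]
    rfl
  rw [unitarySumEnergy, eigenangles, charpoly_unitary_conj hQ, this]
  simp only [Multiset.map_map, Function.comp_def, abs_arg_conj]
  rfl

section
attribute [local instance] Matrix.linftyOpNormedRing Matrix.linftyOpNormedAlgebra

/-- Cyclicity of the trace merges all terms of the noncommutative product rule for `M ^ k`, so `M`
and `M'` need not commute. -/
theorem hasDerivAt_trace_aeval {M : ℝ → Matrix ι ι ℂ} {M' : Matrix ι ι ℂ} {t : ℝ}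
    (h : ∀ i j, HasDerivAt (fun t => M t i j) (M' i j) t) (p : Polynomial ℂ) :
    HasDerivAt (fun t => (Polynomial.aeval (M t) p).trace)
      (M' * Polynomial.aeval (M t) p.derivative).trace t := by
  have hM : HasDerivAt M M' t := hasDerivAt_pi.2 fun i => hasDerivAt_pi.2 fun j => h i j
  induction p using Polynomial.induction_on' with
  | add p q hp hq =>
    simp only [map_add, Matrix.trace_add, Matrix.mul_add]
    exact hp.add hq
  | monomial k a =>
    have h1 := hM.fun_pow' k
    have h2 : HasDerivAt (fun t => (M t ^ k).trace)
        (∑ i ∈ Finset.range k, M t ^ (k.pred - i) * M' * M t ^ i).trace t := by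
      have h3 := ((Matrix.traceLinearMap ι ℝ ℂ).toContinuousLinearMap).hasFDerivAt.comp_hasDerivAt t h1
      exact h3
    have h4 : (∑ i ∈ Finset.range k, M t ^ (k.pred - i) * M' * M t ^ i).trace =
        k * (M' * M t ^ (k - 1)).trace := by
      rw [Matrix.trace_sum, Finset.sum_congr rfl (g := fun _ => (M' * M t ^ (k - 1)).trace)]
      · simp
      · intro i hi
        rw [Matrix.mul_assoc, Matrix.trace_mul_comm, Matrix.mul_assoc, ← pow_add]
        congr 3
        have := Finset.mem_range.1 hi
        rw [Nat.pred_eq_sub_one]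
        omega
    rw [h4] at h2
    have h5 := h2.const_mul a
    simp only [Polynomial.aeval_monomial, Polynomial.derivative_monomial,
      Algebra.algebraMap_eq_smul_one, smul_one_mul, Matrix.trace_smul, Matrix.mul_smul, smul_eq_mul]
    convert! h5 using 1
    ring

end

/-! ### Rank-one phase rotations and their energy cost. -/

/-- The unitary that multiplies the unit vector `u` by `exp (i t)` and fixes its orthogonal
complement. -/
noncomputable def phaseRotation (u : ι → ℂ) (t : ℝ) : Matrix ι ι ℂ :=
  1 + (Complex.exp (t * Complex.I) - 1) • Matrix.vecMulVec u (star u)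

theorem phaseRotation_mulVec (u x : ι → ℂ) (t : ℝ) :
    phaseRotation u t *ᵥ x = x + ((Complex.exp (t * Complex.I) - 1) * (star u ⬝ᵥ x)) • u := by
  rw [phaseRotation, Matrix.add_mulVec, Matrix.one_mulVec, Matrix.smul_mulVec,
    Matrix.vecMulVec_mulVec, mul_smul]
  simp

theorem vecMulVec_mul_phaseRotation {u : ι → ℂ} (hu : star u ⬝ᵥ u = 1) (t : ℝ) :
    Matrix.vecMulVec u (star u) * phaseRotation u t =
      Complex.exp (t * Complex.I) • Matrix.vecMulVec u (star u) := by
  rw [phaseRotation, Matrix.mul_add, Matrix.mul_one, Matrix.mul_smul,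
    Matrix.vecMulVec_mul_vecMulVec, hu, one_smul, sub_smul, one_smul]
  abel

theorem phaseRotation_conjTranspose {κ : Type*} [DecidableEq κ] (u : κ → ℂ) (t : ℝ) :
    (phaseRotation u t)ᴴ = phaseRotation u (-t) := by
  rw [phaseRotation, phaseRotation, Matrix.conjTranspose_add, Matrix.conjTranspose_smul,
    Matrix.conjTranspose_one, Matrix.conjTranspose_vecMulVec, star_star]
  congr 2
  rw [star_sub, star_one, Complex.star_def, ← Complex.exp_conj]
  simp

theorem phaseRotation_mem_unitaryGroup {u : ι → ℂ} (hu : star u ⬝ᵥ u = 1) (t : ℝ) :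
    phaseRotation u t ∈ Matrix.unitaryGroup ι ℂ := by
  rw [Matrix.mem_unitaryGroup_iff', Matrix.star_eq_conjTranspose, phaseRotation_conjTranspose]
  conv_lhs => rw [phaseRotation]
  rw [Matrix.add_mul, Matrix.one_mul, Matrix.smul_mul, vecMulVec_mul_phaseRotation hu,
    phaseRotation, smul_smul, add_assoc, ← add_smul]
  have : Complex.exp ((-t : ℝ) * Complex.I) * Complex.exp (t * Complex.I) = 1 := by
    rw [← Complex.exp_add]; simp
  rw [sub_mul, this]
  simp

theorem aeval_conj_diagonal {Q : Matrix ι ι ℂ} (hQ : Q ∈ Matrix.unitaryGroup ι ℂ)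
    (z : ι → ℂ) (p : Polynomial ℂ) :
    Polynomial.aeval (Q * Matrix.diagonal z * Qᴴ) p =
      Q * Matrix.diagonal (fun i => p.eval (z i)) * Qᴴ := by
  have hQ1 : Qᴴ * Q = 1 := Matrix.mem_unitaryGroup_iff'.1 hQ
  have hQ2 : Q * Qᴴ = 1 := Matrix.mem_unitaryGroup_iff.1 hQ
  rw [← aeval_mul_eq_mul_diagonal (U := Q * Matrix.diagonal z * Qᴴ),
    Matrix.mul_assoc (Polynomial.aeval _ p), hQ2, Matrix.mul_one]
  rw [Matrix.mul_assoc, hQ1, Matrix.mul_one]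

/-- In an eigenbasis of `U` the quadratic form is a convex combination of the values of `q` at the
eigenvalues, with weights `‖y i‖ ^ 2`. -/
theorem abs_im_dotProduct_aeval_le {U : Matrix ι ι ℂ} (hU : U ∈ Matrix.unitaryGroup ι ℂ)
    {u : ι → ℂ} (hu : star u ⬝ᵥ u = 1) {q : Polynomial ℂ} {c : ℝ}
    (hq : ∀ z : ℂ, ‖z‖ = 1 → |(q.eval z).im| ≤ c) :
    |(star u ⬝ᵥ Polynomial.aeval U q *ᵥ u).im| ≤ c := by
  obtain ⟨Q, hQ, z, hz, rfl⟩ := exists_unitary_mul_diagonal hU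
  have hQ2 : Q * Qᴴ = 1 := Matrix.mem_unitaryGroup_iff.1 hQ
  rw [aeval_conj_diagonal hQ]
  have h1 : ∀ x : ι → ℂ, star u ⬝ᵥ (Q *ᵥ x) = star (Qᴴ *ᵥ u) ⬝ᵥ x := by
    intro x
    rw [Matrix.star_mulVec, Matrix.conjTranspose_conjTranspose, Matrix.dotProduct_mulVec]
  set y := Qᴴ *ᵥ u with hy
  have hy1 : star y ⬝ᵥ y = 1 := by
    rw [← h1, hy, Matrix.mulVec_mulVec, hQ2, Matrix.one_mulVec, hu]
  have hn : ∀ i, star (y i) * y i = ((‖y i‖ ^ 2 : ℝ) : ℂ) := fun i => by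
    rw [Complex.star_def, Complex.conj_mul']; push_cast; rfl
  have hy2 : ∑ i, ‖y i‖ ^ 2 = 1 := by
    have : ((∑ i, ‖y i‖ ^ 2 : ℝ) : ℂ) = 1 := by
      rw [← hy1, dotProduct, Complex.ofReal_sum]
      exact Finset.sum_congr rfl fun i _ => (hn i).symm
    exact_mod_cast this
  rw [← Matrix.mulVec_mulVec, ← Matrix.mulVec_mulVec, h1, ← hy, dotProduct, Complex.im_sum]
  calc |∑ i, (star y i * (Matrix.diagonal (fun i => q.eval (z i)) *ᵥ y) i).im|
      ≤ ∑ i, |(star y i * (Matrix.diagonal (fun i => q.eval (z i)) *ᵥ y) i).im| :=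
        Finset.abs_sum_le_sum_abs _ _
    _ ≤ ∑ i, ‖y i‖ ^ 2 * c := by
        refine Finset.sum_le_sum fun i _ => ?_
        rw [Matrix.mulVec_diagonal, mul_left_comm, Pi.star_apply, hn, mul_comm,
          Complex.im_ofReal_mul, abs_mul, abs_of_nonneg (by positivity)]
        exact mul_le_mul_of_nonneg_left (hq _ (hz i)) (by positivity)
    _ = c := by rw [← Finset.sum_mul, hy2, one_mul]

theorem abs_unitarySumEnergy_sub_le {U : Matrix ι ι ℂ} (hU : U ∈ Matrix.unitaryGroup ι ℂ)
    {p : Polynomial ℂ} {ε : ℝ} (hp : ∀ z : ℂ, ‖z‖ = 1 → |(p.eval z).re - (|z.arg|)| ≤ ε) :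
    |(Polynomial.aeval U p).trace.re - unitarySumEnergy U| ≤ Fintype.card ι * ε := by
  obtain ⟨Q, hQ, z, hz, rfl⟩ := exists_unitary_mul_diagonal hU
  have hQ1 : Qᴴ * Q = 1 := Matrix.mem_unitaryGroup_iff'.1 hQ
  rw [aeval_conj_diagonal hQ, unitarySumEnergy_conj_diagonal hQ, Matrix.mul_assoc,
    Matrix.trace_mul_comm, Matrix.mul_assoc, hQ1, Matrix.mul_one, Matrix.trace_diagonal,
    Complex.re_sum, ← Finset.sum_sub_distrib]
  refine (Finset.abs_sum_le_sum_abs _ _).trans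
    ((Finset.sum_le_sum fun i _ => hp _ (hz i)).trans_eq ?_)
  simp

theorem abs_trace_aeval_phaseRotation_mul_sub_le {U : Matrix ι ι ℂ}
    (hU : U ∈ Matrix.unitaryGroup ι ℂ) {u : ι → ℂ} (hu : star u ⬝ᵥ u = 1) {p : Polynomial ℂ}
    {c : ℝ} (hp : ∀ z : ℂ, ‖z‖ = 1 → |(z * p.derivative.eval z).im| ≤ c) (t : ℝ) :
    |(Polynomial.aeval (phaseRotation u t * U) p).trace.re - (Polynomial.aeval U p).trace.re| ≤
      c * |t| := by
  have hR : ∀ s, phaseRotation u s * U ∈ Matrix.unitaryGroup ι ℂ := fun s =>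
    mul_mem (phaseRotation_mem_unitaryGroup hu s) hU
  have hd : ∀ s : ℝ, HasDerivAt (fun s => (Polynomial.aeval (phaseRotation u s * U) p).trace.re)
      (-(star u ⬝ᵥ Polynomial.aeval (phaseRotation u s * U) (Polynomial.X * p.derivative) *ᵥ u).im)
      s := by
    intro s
    have he : HasDerivAt (fun s : ℝ => Complex.exp (s * Complex.I))
        (Complex.exp (s * Complex.I) * Complex.I) s := by
      simpa using ((Complex.ofRealCLM.hasDerivAt (x := s)).mul_const Complex.I).cexp
    have h := hasDerivAt_trace_aeval (M := fun s => phaseRotation u s * U)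
      (M' := (Complex.exp (s * Complex.I) * Complex.I) • (Matrix.vecMulVec u (star u) * U)) (t := s)
      (fun i j => by
        simp only [phaseRotation, Matrix.add_mul, Matrix.smul_mul, Matrix.add_apply,
          Matrix.smul_apply, smul_eq_mul]
        exact ((he.sub_const 1).mul_const _).const_add _) p
    -- Since `u u* R_s = exp (i s) u u*`, the velocity of `V = R_s U` is `i u u* V`; its trace
    -- against `p'(V)` is a quadratic form at `u`.
    have h2 : ((Complex.exp (s * Complex.I) * Complex.I) • (Matrix.vecMulVec u (star u) * U) *
        Polynomial.aeval (phaseRotation u s * U) p.derivative).trace = Complex.I *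
        (star u ⬝ᵥ Polynomial.aeval (phaseRotation u s * U) (Polynomial.X * p.derivative) *ᵥ u) := by
      rw [mul_comm (Complex.exp _), mul_smul, ← Matrix.smul_mul (Complex.exp _),
        ← vecMulVec_mul_phaseRotation hu, Matrix.mul_assoc _ _ U, Matrix.smul_mul, Matrix.mul_assoc,
        Matrix.trace_smul, smul_eq_mul, map_mul, Polynomial.aeval_X, Matrix.vecMulVec_mul,
        Matrix.trace_vecMulVec, Matrix.dotProduct_mulVec, dotProduct_comm]
    rw [h2] at h
    have h3 := Complex.reCLM.hasFDerivAt.comp_hasDerivAt s h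
    convert! h3 using 1
    simp
  have := Convex.norm_image_sub_le_of_norm_deriv_le (s := Set.univ) (C := c)
    (f := fun s => (Polynomial.aeval (phaseRotation u s * U) p).trace.re) (x := 0) (y := t)
    (fun s _ => (hd s).differentiableAt) (fun s _ => ?_) convex_univ trivial trivial
  · simpa [phaseRotation] using this
  · rw [(hd s).deriv, norm_neg]
    exact abs_im_dotProduct_aeval_le (hR s) hu fun z hz => by simpa using hp z hz

/-- Multiplying by a rank-one phase rotation of angle `t` raises the sum time-energy by at most
`|t|`. -/
theorem unitarySumEnergy_phaseRotation_mul_le {U : Matrix ι ι ℂ}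
    (hU : U ∈ Matrix.unitaryGroup ι ℂ) {u : ι → ℂ} (hu : star u ⬝ᵥ u = 1) (t : ℝ) :
    unitarySumEnergy (phaseRotation u t * U) ≤ unitarySumEnergy U + |t| := by
  refine le_of_forall_pos_le_add fun ε hε => ?_
  -- With tolerance `ε / c`, the two approximation errors contribute `2 * card` and the derivative
  -- bound `|t|` multiples of it, which together stay below `ε`.
  let c : ℝ := |t| + 2 * Fintype.card ι + 1
  have hc : 0 < c := by positivity
  obtain ⟨p, hp⟩ := exists_polynomial_near_abs_arg (div_pos hε hc)
  have h1 := abs_le.1 (abs_unitarySumEnergy_sub_le hU fun z hz => (hp z hz).1)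
  have h2 := abs_le.1 (abs_unitarySumEnergy_sub_le
    (mul_mem (phaseRotation_mem_unitaryGroup hu t) hU) fun z hz => (hp z hz).1)
  have h3 := abs_le.1 (abs_trace_aeval_phaseRotation_mul_sub_le hU hu
    (fun z hz => (hp z hz).2) t)
  have h4 : ε / c * c = ε := div_mul_cancel₀ _ hc.ne'
  have h5 : 0 < ε / c := by positivity
  simp only [c] at h4
  nlinarith [h1.1, h1.2, h2.1, h2.2, h3.1, h3.2]

open scoped ComplexOrder in
-- Normalised form of the phase rotation. The zero vector is admitted because an axis degenerates
-- when the vectors `e`, `f` to be matched are parallel.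
theorem exists_phase_unitary (u : ι → ℂ) (t : ℝ) :
    ∃ R ∈ Matrix.unitaryGroup ι ℂ, R *ᵥ u = Complex.exp (t * Complex.I) • u ∧
      (∀ x, star u ⬝ᵥ x = 0 → R *ᵥ x = x) ∧
      ∀ U ∈ Matrix.unitaryGroup ι ℂ,
        unitarySumEnergy (R * U) ≤ unitarySumEnergy U + |t| := by
  rcases eq_or_ne u 0 with rfl | hu
  · exact ⟨1, one_mem _, by simp, by simp, fun U _ => by simp⟩
  have h0 : star u ⬝ᵥ u ≠ 0 := fun h => hu (dotProduct_star_self_eq_zero.1 h)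
  have hpos : 0 ≤ star u ⬝ᵥ u := dotProduct_star_self_nonneg u
  obtain ⟨s, hs0, hs⟩ : ∃ s : ℝ, s ≠ 0 ∧ (s : ℂ) * s * (star u ⬝ᵥ u) = 1 := by
    obtain ⟨hre, him⟩ := Complex.nonneg_iff.1 hpos
    have e : star u ⬝ᵥ u = ((star u ⬝ᵥ u).re : ℂ) := Complex.ext rfl (by simp [← him])
    have hre0 : (star u ⬝ᵥ u).re ≠ 0 := fun h => h0 (by rw [e, h]; rfl)
    refine ⟨(√(star u ⬝ᵥ u).re)⁻¹, inv_ne_zero ((Real.sqrt_ne_zero hre).2 hre0), ?_⟩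
    rw [e, Complex.ofReal_re]
    norm_cast
    rw [← mul_inv, Real.mul_self_sqrt hre, inv_mul_cancel₀ hre0]
  have hsc : (s : ℂ) ≠ 0 := by exact_mod_cast hs0
  let y : ι → ℂ := (s : ℂ) • u
  have hstar : ∀ x, star y ⬝ᵥ x = s * (star u ⬝ᵥ x) := by
    intro x
    simp [y, star_smul]
  have hy : star y ⬝ᵥ y = 1 := by
    rw [hstar, dotProduct_smul, smul_eq_mul, ← mul_assoc, hs]
  refine ⟨phaseRotation y t, phaseRotation_mem_unitaryGroup hy t, ?_, fun x hx => ?_,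
    fun U hU => unitarySumEnergy_phaseRotation_mul_le hU hy t⟩
  · rw [phaseRotation_mulVec, hstar, smul_smul, show (Complex.exp (t * Complex.I) - 1) *
      (s * (star u ⬝ᵥ u)) * s = Complex.exp (t * Complex.I) - 1 by
        linear_combination (Complex.exp (t * Complex.I) - 1) * hs, sub_smul, one_smul]
    abel
  · rw [phaseRotation_mulVec, hstar, hx]
    simp

/-! ### Moving one orthonormal family onto another. -/

open scoped ComplexOrder in
/-- A unitary that takes the unit vector `e` to `f` by rotating only their span, through opposite
angles along two orthogonal directions. -/
theorem exists_unitary_mulVec_eq {e f : ι → ℂ} (he : star e ⬝ᵥ e = 1) (hf : star f ⬝ᵥ f = 1) :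
    ∃ W ∈ Matrix.unitaryGroup ι ℂ, W *ᵥ e = f ∧
      (∀ x, star e ⬝ᵥ x = 0 → star f ⬝ᵥ x = 0 → W *ᵥ x = x) ∧
      ∀ U ∈ Matrix.unitaryGroup ι ℂ,
        unitarySumEnergy (W * U) ≤ unitarySumEnergy U + 2 * Real.arccos (star e ⬝ᵥ f).re := by
  have hfe : star f ⬝ᵥ e = star (star e ⬝ᵥ f) := by
    rw [Matrix.star_dotProduct]
  have hsum : star e ⬝ᵥ f + star f ⬝ᵥ e = ((2 * (star e ⬝ᵥ f).re : ℝ) : ℂ) := by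
    rw [hfe, Complex.star_def, Complex.add_conj]
  have hsub : star (f - e) ⬝ᵥ (f - e) = ((2 - 2 * (star e ⬝ᵥ f).re : ℝ) : ℂ) := by
    rw [star_sub, sub_dotProduct, dotProduct_sub, dotProduct_sub, he, hf, Complex.ofReal_sub,
      ← hsum]
    push_cast
    ring
  have hadd : star (f + e) ⬝ᵥ (f + e) = ((2 + 2 * (star e ⬝ᵥ f).re : ℝ) : ℂ) := by
    rw [star_add, add_dotProduct, dotProduct_add, dotProduct_add, he, hf, Complex.ofReal_add,
      ← hsum]
    push_cast
    ring
  set c := (star e ⬝ᵥ f).re with hc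
  have hc1 : c ≤ 1 := by
    have := dotProduct_star_self_nonneg (f - e)
    rw [hsub, Complex.zero_le_real] at this
    linarith
  have hc2 : -1 ≤ c := by
    have := dotProduct_star_self_nonneg (f + e)
    rw [hadd, Complex.zero_le_real] at this
    linarith
  -- At `c = 1` and `c = -1` the phases `w` and `w'` coincide and the two-axis construction breaks
  -- down; there `f = e` or `f = -e`.
  rcases hc1.eq_or_lt with h1 | h1
  · have : f = e := by
      rw [← sub_eq_zero, ← dotProduct_star_self_eq_zero, hsub, h1]
      norm_num
    subst this
    exact ⟨1, one_mem _, by simp, by simp, fun U _ => by simp [Real.arccos_nonneg]⟩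
  rcases hc2.eq_or_lt with h2 | h2
  · have : f = -e := by
      rw [← sub_eq_zero, sub_neg_eq_add, ← dotProduct_star_self_eq_zero, hadd, ← h2]
      norm_num
    obtain ⟨R, hR, h3, h4, h5⟩ := exists_phase_unitary e Real.pi
    refine ⟨R, hR, ?_, fun x hx _ => h4 x hx, fun U hU => (h5 U hU).trans ?_⟩
    · rw [h3, Complex.exp_pi_mul_I, this]
      simp
    · rw [← h2, Real.arccos_neg_one, abs_of_pos Real.pi_pos]
      linarith [Real.pi_pos]
  set α := Real.arccos c with hα
  have hcos : Real.cos α = c := Real.cos_arccos hc2 hc1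
  let w : ℂ := Complex.exp (α * Complex.I)
  let w' : ℂ := Complex.exp ((-α : ℝ) * Complex.I)
  have hww : w * w' = 1 := by
    simp only [w, w']
    rw [← Complex.exp_add]
    simp
  have hsw : star w = w' := by
    simp only [w, w']
    rw [Complex.star_def, ← Complex.exp_conj]
    simp
  have hsw' : star w' = w := by rw [← hsw, star_star]
  have hws : w + w' = ((2 * c : ℝ) : ℂ) := by
    rw [← hsw, Complex.star_def, Complex.add_conj, ← hcos, Complex.exp_ofReal_mul_I_re]
  have hne : w - w' ≠ 0 := by
    intro h
    have h6 : w.im - w'.im = 0 := by rw [← Complex.sub_im, h]; rfl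
    simp only [w, w', Complex.exp_ofReal_mul_I_im, Real.sin_neg] at h6
    have h7 : 0 < Real.sin α := Real.sin_pos_of_pos_of_lt_pi (Real.arccos_pos.2 h1) (by
      refine lt_of_le_of_ne (Real.arccos_le_pi c) fun h => ?_
      rw [h, Real.cos_pi] at hcos
      linarith)
    linarith
  -- The axes are chosen so that `a - b` is `(w - w') • e` while `w • a - w' • b` is `(w - w') • f`.
  -- They are orthogonal because `w` is a root of `X ^ 2 - 2 c X + 1`; only the real part of the
  -- overlap enters.
  let a : ι → ℂ := f - w' • e
  let b : ι → ℂ := f - w • e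
  have hab : star a ⬝ᵥ b = 0 := by
    simp only [a, b, star_sub, star_smul, hsw', sub_dotProduct, dotProduct_sub, smul_dotProduct,
      dotProduct_smul, he, hf, smul_eq_mul]
    linear_combination (-w) * hsum + w * hws - hww
  have hba : star b ⬝ᵥ a = 0 := by
    rw [Matrix.star_dotProduct, hab, star_zero]
  obtain ⟨R, hR, hR1, hR2, hR3⟩ := exists_phase_unitary a α
  obtain ⟨S, hS, hS1, hS2, hS3⟩ := exists_phase_unitary b (-α)
  refine ⟨R * S, mul_mem hR hS, ?_, fun x hx hx' => ?_, fun U hU => ?_⟩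
  · have h8 : (w - w') • e = a - b := by
      simp only [a, b, sub_smul]
      abel
    have h9 : (R * S) *ᵥ ((w - w') • e) = (w - w') • f := by
      rw [h8, ← Matrix.mulVec_mulVec, Matrix.mulVec_sub, hS2 a hba, hS1, Matrix.mulVec_sub, hR1,
        Matrix.mulVec_smul, hR2 b hab]
      change w • (f - w' • e) - w' • (f - w • e) = _
      rw [smul_sub, smul_sub, smul_smul, smul_smul, mul_comm w' w, sub_smul]
      abel
    rw [Matrix.mulVec_smul] at h9
    exact smul_right_injective _ hne h9
  · rw [← Matrix.mulVec_mulVec, hS2 x, hR2 x]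
    · simp [a, star_smul, sub_dotProduct, hx, hx']
    · simp [b, star_smul, sub_dotProduct, hx, hx']
  · have h10 := hR3 (S * U) (mul_mem hS hU)
    have h11 := hS3 U hU
    rw [abs_neg] at h11
    rw [abs_of_nonneg (Real.arccos_nonneg c)] at h10 h11
    rw [Matrix.mul_assoc]
    linarith

theorem unitarySumEnergy_one : unitarySumEnergy (1 : Matrix ι ι ℂ) = 0 := by
  have := unitarySumEnergy_conj_diagonal (one_mem (Matrix.unitaryGroup ι ℂ)) (fun _ => 1)
  simpa using this

/-- Orthonormal families `e`, `f` with upper triangular overlaps are related by a unitary whose sum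
time-energy is bounded by twice the angles of the diagonal overlaps. -/
theorem exists_unitary_mulVec_eq_of_triangular (n : ℕ) :
    ∀ e f : Fin n → ι → ℂ,
      (∀ i j, star (e i) ⬝ᵥ e j = if i = j then 1 else 0) →
      (∀ i j, star (f i) ⬝ᵥ f j = if i = j then 1 else 0) →
      (∀ i j, j < i → star (e i) ⬝ᵥ f j = 0) →
      ∃ U ∈ Matrix.unitaryGroup ι ℂ, (∀ i, U *ᵥ e i = f i) ∧
        (∀ x, (∀ i, star (e i) ⬝ᵥ x = 0) → (∀ i, star (f i) ⬝ᵥ x = 0) → U *ᵥ x = x) ∧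
        unitarySumEnergy U ≤ ∑ i, 2 * Real.arccos (star (e i) ⬝ᵥ f i).re := by
  induction n with
  | zero =>
    intro e f _ _ _
    exact ⟨1, one_mem _, fun i => i.elim0, by simp, by simp [unitarySumEnergy_one]⟩
  | succ n ih =>
    intro e f he hf hef
    obtain ⟨U, hU, hU1, hU2, hU3⟩ := ih (fun i => e i.castSucc) (fun i => f i.castSucc)
      (fun i j => by simpa using he i.castSucc j.castSucc)
      (fun i j => by simpa using hf i.castSucc j.castSucc)
      (fun i j hij => hef _ _ (by simpa using hij))
    obtain ⟨W, hW, hW1, hW2, hW3⟩ := exists_unitary_mulVec_eq (e := e (Fin.last n))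
      (f := f (Fin.last n)) (by simpa using he (Fin.last n) (Fin.last n))
      (by simpa using hf (Fin.last n) (Fin.last n))
    -- `U` fixes the last `e`, which is orthogonal to all earlier `e` and, by triangularity, to all
    -- earlier `f`. `W` fixes the earlier `f` for the same reason.
    refine ⟨W * U, mul_mem hW hU, fun i => ?_, fun x hx hx' => ?_, ?_⟩
    · rw [← Matrix.mulVec_mulVec]
      induction i using Fin.lastCases with
      | last =>
        rw [hU2, hW1]
        · intro i
          rw [he, if_neg (Fin.castSucc_lt_last i).ne]
        · intro i
          rw [Matrix.star_dotProduct, hef _ _ (Fin.castSucc_lt_last i), star_zero]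
      | cast i =>
        rw [hU1, hW2]
        · exact hef _ _ (Fin.castSucc_lt_last i)
        · rw [hf, if_neg (Fin.castSucc_lt_last i).ne']
    · rw [← Matrix.mulVec_mulVec, hU2 x (fun i => hx _) (fun i => hx' _), hW2 x (hx _) (hx' _)]
    · rw [Fin.sum_univ_castSucc]
      exact (hW3 U hU).trans (by linarith)

end

/-! ### Freedom in the Kraus representation and the resulting dilation. -/

theorem IsKrausRepresentation.unitary_mix {n d : ℕ} {F : Fin d → Matrix (Fin n) (Fin n) ℂ}
    {Φ : Matrix (Fin n) (Fin n) ℂ →ₗ[ℂ] Matrix (Fin n) (Fin n) ℂ}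
    (hF : IsKrausRepresentation F Φ) {u : Matrix (Fin d) (Fin d) ℂ}
    (hu : u ∈ Matrix.unitaryGroup (Fin d) ℂ) :
    IsKrausRepresentation (fun i => ∑ j, u i j • F j) Φ := by
  have h1 : ∀ j k, ∑ i, star (u i j) * u i k = if j = k then 1 else 0 := by
    intro j k
    have := congrFun (congrFun (Matrix.mem_unitaryGroup_iff'.1 hu) j) k
    simpa [Matrix.mul_apply, Matrix.one_apply, Matrix.star_eq_conjTranspose] using this
  refine ⟨?_, fun ρ => ?_⟩
  · rw [← hF.1]
    simp only [Matrix.conjTranspose_sum, Matrix.conjTranspose_smul, Finset.sum_mul, Finset.mul_sum,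
      Matrix.smul_mul, Matrix.mul_smul, smul_smul]
    rw [Finset.sum_comm]
    refine Finset.sum_congr rfl fun j _ => ?_
    rw [Finset.sum_comm]
    simp only [← Finset.sum_smul]
    simp_rw [mul_comm (u _ _) (star _), h1]
    simp
  · rw [hF.2]
    simp only [Matrix.conjTranspose_sum, Matrix.conjTranspose_smul, Finset.sum_mul, Finset.mul_sum,
      Matrix.smul_mul, Matrix.mul_smul, smul_smul]
    symm
    rw [Finset.sum_comm]
    refine Finset.sum_congr rfl fun j _ => ?_
    rw [Finset.sum_comm]
    simp only [← Finset.sum_smul]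
    simp_rw [h1]
    simp

theorem IsKrausRepresentation.cons_zero {n d : ℕ} {F : Fin d → Matrix (Fin n) (Fin n) ℂ}
    {Φ : Matrix (Fin n) (Fin n) ℂ →ₗ[ℂ] Matrix (Fin n) (Fin n) ℂ}
    (hF : IsKrausRepresentation F Φ) :
    IsKrausRepresentation (Fin.cons 0 F : Fin (d + 1) → Matrix (Fin n) (Fin n) ℂ) Φ :=
  ⟨by simpa [Fin.sum_univ_succ] using hF.1, fun ρ => by simpa [Fin.sum_univ_succ] using hF.2 ρ⟩

theorem exists_unitary_row_zero {d : ℕ} (w : EuclideanSpace ℂ (Fin (d + 1))) (hw : ‖w‖ = 1) :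
    ∃ u ∈ Matrix.unitaryGroup (Fin (d + 1)) ℂ, ∀ j, u 0 j = w j := by
  let s : Set (Fin (d + 1)) := {0}
  have hon : Orthonormal ℂ (s.domRestrict fun _ => w) := by
    rw [orthonormal_iff_ite]
    rintro ⟨i, hi⟩ ⟨j, hj⟩
    have hi' : i = 0 := hi
    have hj' : j = 0 := hj
    subst hi' hj'
    simp [hw]
  obtain ⟨b, hb⟩ := hon.exists_orthonormalBasis_extension_of_card_eq (by simp)
  refine ⟨Matrix.of fun i j => b i j, ?_, fun j => by simp [hb 0 rfl]⟩
  rw [Matrix.mem_unitaryGroup_iff]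
  ext i j
  -- The indices are swapped because the inner product conjugates its first argument.
  have h := orthonormal_iff_ite.1 b.orthonormal j i
  rw [PiLp.inner_apply] at h
  rw [Matrix.one_apply, Matrix.star_eq_conjTranspose, Matrix.mul_apply]
  simp only [eq_comm (a := j)] at h
  rw [← h]
  simp

theorem IsKrausRepresentation.exists_head_eq {n d : ℕ} {F : Fin d → Matrix (Fin n) (Fin n) ℂ}
    {Φ : Matrix (Fin n) (Fin n) ℂ →ₗ[ℂ] Matrix (Fin n) (Fin n) ℂ}
    (hF : IsKrausRepresentation F Φ) {v : EuclideanSpace ℂ (Fin d)} (hv : ‖v‖ ≤ 1) :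
    ∃ G : Fin (d + 1) → Matrix (Fin n) (Fin n) ℂ, IsKrausRepresentation G Φ ∧
      G 0 = ∑ j, v j • F j := by
  -- The slack coordinate multiplies the added zero operator, so it restores unit norm without
  -- changing the combination of the `F j`.
  let w : EuclideanSpace ℂ (Fin (d + 1)) :=
    WithLp.toLp 2 (Fin.cons ((√(1 - ‖v‖ ^ 2) : ℝ) : ℂ) fun j => v j)
  have hw : ‖w‖ = 1 := by
    have h1 : 0 ≤ 1 - ‖v‖ ^ 2 := sub_nonneg.2 (pow_le_one₀ (norm_nonneg _) hv)
    rw [← sq_eq_sq₀ (norm_nonneg _) zero_le_one, EuclideanSpace.norm_sq_eq, Fin.sum_univ_succ]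
    simp only [w, Fin.cons_zero, Fin.cons_succ]
    rw [← EuclideanSpace.norm_sq_eq, Complex.norm_real, Real.norm_of_nonneg (Real.sqrt_nonneg _),
      Real.sq_sqrt h1]
    ring
  obtain ⟨u, hu, hu0⟩ := exists_unitary_row_zero w hw
  refine ⟨_, hF.cons_zero.unitary_mix hu, ?_⟩
  simp [Fin.sum_univ_succ, hu0, w]

theorem IsKrausRepresentation.channelSumEnergy_le {n d : ℕ}
    {G : Fin (d + 1) → Matrix (Fin n) (Fin n) ℂ}
    {Φ : Matrix (Fin n) (Fin n) ℂ →ₗ[ℂ] Matrix (Fin n) (Fin n) ℂ}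
    (hG : IsKrausRepresentation G Φ) {Q : Matrix (Fin n) (Fin n) ℂ}
    (hQ : Q ∈ Matrix.unitaryGroup (Fin n) ℂ) (hT : (Qᴴ * G 0 * Q).IsUpperTriangular) :
    channelSumEnergy Φ ≤ ∑ i, 2 * Real.arccos ((Qᴴ * G 0 * Q) i i).re := by
  have hQ1 : Qᴴ * Q = 1 := Matrix.mem_unitaryGroup_iff'.1 hQ
  have hQ2 : Q * Qᴴ = 1 := Matrix.mem_unitaryGroup_iff.1 hQ
  let e : Fin n → Fin (d + 1) × Fin n → ℂ := fun i p => if p.1 = 0 then Q p.2 i else 0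
  let f : Fin n → Fin (d + 1) × Fin n → ℂ := fun i p => (G p.1 * Q) p.2 i
  have hee : ∀ i j, star (e i) ⬝ᵥ e j = if i = j then 1 else 0 := by
    intro i j
    rw [← Matrix.one_apply, ← hQ1, Matrix.mul_apply, dotProduct, Fintype.sum_prod_type,
      Fin.sum_univ_succ]
    simp [e]
  have hff : ∀ i j, star (f i) ⬝ᵥ f j = if i = j then 1 else 0 := by
    intro i j
    have h1 : ∑ k, (G k * Q)ᴴ * (G k * Q) = 1 := by
      simp only [Matrix.conjTranspose_mul]
      rw [Finset.sum_congr rfl (g := fun k => Qᴴ * ((G k)ᴴ * G k * Q)) fun k _ => by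
        simp only [Matrix.mul_assoc], ← Finset.mul_sum, ← Finset.sum_mul, hG.1, Matrix.one_mul, hQ1]
    rw [← Matrix.one_apply, ← h1, Matrix.sum_apply, dotProduct, Fintype.sum_prod_type]
    refine Finset.sum_congr rfl fun k _ => ?_
    rw [Matrix.mul_apply]
    rfl
  have hef : ∀ i j, star (e i) ⬝ᵥ f j = (Qᴴ * G 0 * Q) i j := by
    intro i j
    rw [Matrix.mul_assoc, Matrix.mul_apply, dotProduct, Fintype.sum_prod_type, Fin.sum_univ_succ]
    simp [e, f]
  obtain ⟨U, hU, hUe, -, hE⟩ := exists_unitary_mulVec_eq_of_triangular n e f hee hff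
    (fun i j hij => by rw [hef]; exact hT hij)
  simp only [hef] at hE
  refine le_trans (csInf_le ⟨0, zero_mem_lowerBounds_implementationEnergies Φ⟩
    ⟨d, U, hU, ?_, rfl⟩) hE
  -- Since `Q` is invertible, the images of the `e i` determine the block column of `U` over `|0⟩`,
  -- the only part that the channel sees.
  have hcol : ∀ p a, U p (0, a) = G p.1 p.2 a := by
    have h1 : Matrix.of (fun p a => U p (0, a)) * Q = Matrix.of (fun p a => G p.1 p.2 a) * Q := by
      ext p i
      have h2 := congrFun (hUe i) p
      rw [Matrix.mulVec, dotProduct, Fintype.sum_prod_type, Fin.sum_univ_succ] at h2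
      simpa [e, f, Matrix.mul_apply] using h2
    have h3 := congrArg (· * Qᴴ) h1
    simp only [Matrix.mul_assoc, hQ2, Matrix.mul_one] at h3
    exact fun p a => congrFun (congrFun h3 p) a
  intro ρ
  rw [hG.2]
  ext x y
  simp only [partialTraceLeft, Matrix.of_apply, Matrix.sum_apply]
  refine Finset.sum_congr rfl fun j _ => ?_
  simp [Matrix.mul_apply, Fintype.sum_prod_type, Matrix.kroneckerMap_apply, Matrix.single_apply,
    hcol, ite_and, Finset.sum_ite_eq, Finset.sum_mul]

/-! ### Attainment of the minimum. -/

theorem eigenvalueBound_eq_sum {n : ℕ} {A Q : Matrix (Fin n) (Fin n) ℂ}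
    (hQ : Q ∈ Matrix.unitaryGroup (Fin n) ℂ) (hT : (Qᴴ * A * Q).IsUpperTriangular) :
    eigenvalueBound A = ∑ i, 2 * Real.arccos ((Qᴴ * A * Q) i i).re := by
  have hQ2 : Q * Qᴴ = 1 := Matrix.mem_unitaryGroup_iff.1 hQ
  have h1 : A.charpoly = (Qᴴ * A * Q).charpoly := by
    rw [Matrix.charpoly_mul_comm, ← Matrix.mul_assoc, hQ2, Matrix.one_mul]
  have h2 : A.charpoly.roots = Finset.univ.val.map fun i => (Qᴴ * A * Q) i i := by
    rw [h1, Matrix.charpoly_of_isUpperTriangular _ hT, ← Polynomial.roots_multiset_prod_X_sub_C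
      (Finset.univ.val.map fun i => (Qᴴ * A * Q) i i), Multiset.map_map]
    rfl
  rw [eigenvalueBound, h2, Multiset.map_map]
  rfl

theorem isCompact_unitaryGroup {n : ℕ} :
    IsCompact {Q : Matrix (Fin n) (Fin n) ℂ | Q ∈ Matrix.unitaryGroup (Fin n) ℂ} := by
  have hsub : {Q : Matrix (Fin n) (Fin n) ℂ | Q ∈ Matrix.unitaryGroup (Fin n) ℂ} ⊆
      Set.univ.pi fun _ => Set.univ.pi fun _ => Metric.closedBall (0 : ℂ) 1 := fun Q hQ i _ j _ => by
    simpa using entry_norm_bound_of_unitary hQ i j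
  refine IsCompact.of_isClosed_subset (isCompact_univ_pi fun _ => isCompact_univ_pi fun _ =>
    isCompact_closedBall _ _) ?_ hsub
  have : {Q : Matrix (Fin n) (Fin n) ℂ | Q ∈ Matrix.unitaryGroup (Fin n) ℂ} =
      {Q | Qᴴ * Q = 1} := by
    ext Q
    exact Matrix.mem_unitaryGroup_iff'
  rw [this]
  exact isClosed_eq (by fun_prop) continuous_const

theorem exists_isLeast_eigenvalueBound {n d : ℕ} (F : Fin d → Matrix (Fin n) (Fin n) ℂ) :
    ∃ m : ℝ, IsLeast {x : ℝ | ∃ v : EuclideanSpace ℂ (Fin d),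
      ‖v‖ ≤ 1 ∧ x = eigenvalueBound (∑ j, v j • F j)} m := by
  let T : EuclideanSpace ℂ (Fin d) × Matrix (Fin n) (Fin n) ℂ → Matrix (Fin n) (Fin n) ℂ :=
    fun q => q.2ᴴ * (∑ j, q.1 j • F j) * q.2
  have hTc : Continuous T := by fun_prop
  have hent : ∀ i j, Continuous fun q => T q i j := fun i j => hTc.matrix_elem i j
  -- On this compact set the bound is a continuous function of diagonal entries, and `K` projects
  -- onto the whole unit ball of vectors `v`.
  let K := (Metric.closedBall (0 : EuclideanSpace ℂ (Fin d)) 1 ×ˢ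
    {Q : Matrix (Fin n) (Fin n) ℂ | Q ∈ Matrix.unitaryGroup (Fin n) ℂ}) ∩
      {q | ∀ i j, j < i → T q i j = 0}
  have hK : IsCompact K := by
    refine ((isCompact_closedBall _ _).prod isCompact_unitaryGroup).inter_right ?_
    simp only [Set.ofPred_forall]
    exact isClosed_iInter fun i => isClosed_iInter fun j => isClosed_iInter fun _ =>
      isClosed_eq (hent i j) continuous_const
  have hmem : ∀ v : EuclideanSpace ℂ (Fin d), ‖v‖ ≤ 1 → ∃ Q, (v, Q) ∈ K := by
    intro v hv
    obtain ⟨Q, hQ, hT⟩ := exists_unitary_isUpperTriangular (∑ j, v j • F j)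
    exact ⟨Q, ⟨by simpa using hv, hQ⟩, fun i j hij => hT hij⟩
  have hval : ∀ q ∈ K, eigenvalueBound (∑ j, q.1 j • F j) =
      ∑ i, 2 * Real.arccos (T q i i).re := fun q hq =>
    eigenvalueBound_eq_sum hq.1.2 fun i j hij => hq.2 i j hij
  obtain ⟨Q₀, hQ₀⟩ := hmem 0 (by simp)
  obtain ⟨q, hq, hmin⟩ := hK.exists_isMinOn ⟨_, hQ₀⟩
    (f := fun q => ∑ i, 2 * Real.arccos (T q i i).re) (by
      refine Continuous.continuousOn (continuous_finsetSum _ fun i _ => ?_)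
      exact continuous_const.mul
        (Real.continuous_arccos.comp (Complex.continuous_re.comp (hent i i))))
  refine ⟨_, ⟨q.1, by simpa using hq.1.1, (hval q hq).symm⟩, ?_⟩
  rintro x ⟨v, hv, rfl⟩
  obtain ⟨Q, hQ⟩ := hmem v hv
  rw [hval _ hQ]
  exact hmin hQ

theorem mainTheorem4 {n d : ℕ} (F : Fin d → Matrix (Fin n) (Fin n) ℂ)
    (Φ : Matrix (Fin n) (Fin n) ℂ →ₗ[ℂ] Matrix (Fin n) (Fin n) ℂ)
    (hF : IsKrausRepresentation F Φ) :
    ∃ m : ℝ,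
      IsLeast {x : ℝ | ∃ v : EuclideanSpace ℂ (Fin d),
        ‖v‖ ≤ 1 ∧ x = eigenvalueBound (∑ j, v j • F j)} m ∧
      channelSumEnergy Φ ≤ m := by
  obtain ⟨m, hm⟩ := exists_isLeast_eigenvalueBound F
  refine ⟨m, hm, ?_⟩
  obtain ⟨v, hv, rfl⟩ := hm.1
  obtain ⟨G, hG, hG0⟩ := hF.exists_head_eq hv
  obtain ⟨Q, hQ, hT⟩ := exists_unitary_isUpperTriangular (G 0)
  rw [← hG0, eigenvalueBound_eq_sum hQ hT]
  exact hG.channelSumEnergy_le hQ hT
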